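/- Let $A,V,Q\in\mathbb R^{n\times n}$ with $V$ symmetric positive semidefinite and $Q$ symmetric, and let $\alpha\in\mathbb R$, $\alpha\neq 0$, $T\ge 0$. Let $x(t)$, $t\ge 0$, be a solution with continuous paths of $dx(t)=Ax(t)\,dt+dw(t)$, that is, $x(t)=x(0)+\int_0^t Ax(s)\,ds+w(t)$ for all $t \ge 0$ almost surely, where $w$ is an $n$-dimensional Brownian motion with $w(0)=0$ and covariance $V\,dt$ (the increment $w(t)-w(s)$, $s\le t$, is $N(0,(t-s)V)$), and the initial state $x(0)$ is Gaussian (with arbitrary mean, possibly degenerate) and independent of $w$. Write $\Sigma(t)=\mathbb E[x(t)x(t)^{\mathsf T}]$, $\Sigma_0=\Sigma(0)$, $A_\alpha=A+\alpha I$, and $J_T=\int_0^T e^{2\alpha t}x(t)^{\mathsf T}Qx(t)\,dt$. Call a real square matrix Sylvester if it has no two complex eigenvalues $\lambda_i,\lambda_j$ (possibly $i=j$) with $\lambda_i=-\lambda_j$. Assume that $A$ and $A_\alpha$ are Sylvester. Then the Lyapunov equation $A_\alpha^{\mathsf T}\bar X_\alpha^Q+\bar X_\alpha^Q A_\alpha+Q=0$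 has a unique solution $\bar X_\alpha^Q\in\mathbb R^{n\times n}$, the second moments $\Sigma_0$ and $\Sigma(T)$ are finite, $J_T$ is integrable, and $$\mathbb E[J_T]=\operatorname{tr}\left(\left(\Sigma_0-e^{2\alpha T}\Sigma(T)+\left(1-e^{2\alpha T}\right)\left(\frac{-V}{2\alpha}\right)\right)\bar X_\alpha^Q\right).$$ -/

import Mathlib

open MeasureTheory ProbabilityTheory
open scoped NNReal Matrix

noncomputable section

namespace LQG

/-- The matrix `A_α = A + α I`. -/
def shifted {n : ℕ} (A : Matrix (Fin n) (Fin n) ℝ) (α : ℝ) : Matrix (Fin n) (Fin n) ℝ :=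
  A + α • (1 : Matrix (Fin n) (Fin n) ℝ)

/-- A real square matrix is *Sylvester* if no two of its (complex) eigenvalues, possibly equal
to each other, satisfy `a = -b`. -/
def IsSylvester {n : ℕ} (A : Matrix (Fin n) (Fin n) ℝ) : Prop :=
  ∀ a b : ℂ,
    Module.End.HasEigenvalue (Matrix.toLin' (A.map (algebraMap ℝ ℂ))) a →
    Module.End.HasEigenvalue (Matrix.toLin' (A.map (algebraMap ℝ ℂ))) b → a ≠ -b

/-- `X` solves the Lyapunov equation `Aᵀ X + X A + Q = 0`. -/
def IsLyapunovBarSolution {n : ℕ} (A Q X : Matrix (Fin n) (Fin n) ℝ) : Prop :=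
  Aᵀ * X + X * A + Q = 0

/-- An `n`-dimensional Brownian motion started at `0` whose increments over a time step `h` have
covariance matrix `h • V` (white noise of intensity `V` is its formal derivative). -/
structure IsBrownianMotion {n : ℕ} {Ω : Type*} [MeasurableSpace Ω]
    (V : Matrix (Fin n) (Fin n) ℝ) (w : ℝ≥0 → Ω → EuclideanSpace ℝ (Fin n))
    (P : Measure Ω) : Prop where
  start_zero : ∀ᵐ ω ∂P, w 0 ω = 0
  indep_increments : HasIndepIncrements w P
  law_increments : ∀ s t : ℝ≥0, s ≤ t →
    HasLaw (fun ω ↦ w t ω - w s ω) (multivariateGaussian 0 (((t : ℝ) - (s : ℝ)) • V)) P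
  continuous_paths : ∀ᵐ ω ∂P, Continuous (fun t ↦ w t ω)

/-- `x` is a solution with continuous paths of `dx(t) = A x(t) dt + dw(t)`, `t ≥ 0`. As the noise
is additive, this is the integral equation `x(t) = x(0) + ∫₀ᵗ A x(s) ds + w(t)`. -/
structure IsSolution {n : ℕ} {Ω : Type*} [MeasurableSpace Ω]
    (A : Matrix (Fin n) (Fin n) ℝ) (w x : ℝ≥0 → Ω → EuclideanSpace ℝ (Fin n))
    (P : Measure Ω) : Prop where
  aemeasurable : ∀ t : ℝ≥0, AEMeasurable (x t) P
  continuous_paths : ∀ᵐ ω ∂P, Continuous (fun t ↦ x t ω)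
  integral_eq : ∀ᵐ ω ∂P, ∀ t : ℝ≥0,
    x t ω = x 0 ω
      + (∫ s in (0 : ℝ)..(t : ℝ), Matrix.toEuclideanCLM (𝕜 := ℝ) A (x s.toNNReal ω))
      + w t ω

/-- The matrix `E[X Xᵀ]` of a random vector `X`. -/
def secondMoment {n : ℕ} {Ω : Type*} [MeasurableSpace Ω]
    (X : Ω → EuclideanSpace ℝ (Fin n)) (P : Measure Ω) : Matrix (Fin n) (Fin n) ℝ :=
  Matrix.of fun i j ↦ ∫ ω, X ω i * X ω j ∂P

/-- The finite-time cost `J_T = ∫₀ᵀ e^{2αt} x(t)ᵀ Q x(t) dt`. -/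
def finiteTimeCost {n : ℕ} {Ω : Type*} (α : ℝ) (Q : Matrix (Fin n) (Fin n) ℝ)
    (x : ℝ≥0 → Ω → EuclideanSpace ℝ (Fin n)) (T : ℝ≥0) (ω : Ω) : ℝ :=
  ∫ t in (0 : ℝ)..(T : ℝ),
    Real.exp (2 * α * t) *
      ((x t.toNNReal ω).ofLp ⬝ᵥ Q *ᵥ (x t.toNNReal ω).ofLp)

end LQG

end

/-! ### Unique solvability of the Lyapunov equation. -/

section Lyapunov

open Polynomial

/-! The second moments `S(t) = E[x(t)x(t)ᵀ]` satisfy `S' = AS + SAᵀ + V` in integrated form. If `X`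
solves the Lyapunov equation for `A + αI`, then `φ = tr(SX)` satisfies `φ' + 2αφ = tr(VX) - tr(QS)`.
Hence `e^{2αt} tr(QS)` is the derivative of `e^{2αt}((2α)⁻¹ tr(VX) - φ)`, and Fubini turns the
expected cost into boundary values (`integral_exp_mul_trace`, `integral_cost`).

No Itô calculus is needed: the noise is additive, so `x - w` is pathwise C¹ with derivative `Ax`,
and the ordinary product rule applies to `(x - w)(x - w)ᵀ`. Taking expectations leaves the cross
moments `E[x wᵀ]`. They obey a closed equation, because the state is uncorrelated with future noise
increments (`integral_state_mul_noise_eq`), and they cancel in `integral_state_mul_state`. All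
moments exist by a pathwise Gronwall-type bound, `norm_sq_le_of_eq_integral_clm_add`.

Existence and uniqueness of `X` is injectivity of `X ↦ AᵀX + XA` for Sylvester `A`, applied to `A +
αI`. -/

theorem Matrix.aeval_mul_eq_mul_aeval {m : Type*} [Fintype m] [DecidableEq m] {R : Type*}
    [CommRing R] {B C X : Matrix m m R} (h : B * X = X * C) (p : R[X]) :
    aeval B p * X = X * aeval C p := by
  induction p using Polynomial.induction_on' with
  | add p q hp hq => rw [map_add, map_add, add_mul, mul_add, hp, hq]
  | monomial k a =>
    have hk : ∀ k : ℕ, B ^ k * X = X * C ^ k := by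
      intro k
      induction k with
      | zero => simp
      | succ k ih => rw [pow_succ, mul_assoc, h, ← mul_assoc, ih, mul_assoc, ← pow_succ]
    rw [aeval_monomial, aeval_monomial, mul_assoc, hk, ← mul_assoc, ← mul_assoc,
      Algebra.commutes]

/-- The homogeneous Sylvester equation `B X = X C` has only the trivial solution when `B` and `C`
have no common eigenvalue. -/
theorem Matrix.eq_zero_of_mul_eq_mul_of_disjoint_spectrum {m : Type*} [Fintype m] [DecidableEq m]
    {K : Type*} [Field K] [IsAlgClosed K] {B C X : Matrix m m K}
    (hd : Disjoint (spectrum K B) (spectrum K C)) (h : B * X = X * C) : X = 0 := by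
  -- The characteristic polynomial of `B` at `C` is a product of factors `C - b` with `b` an
  -- eigenvalue of `B`; each is invertible since `b` is not in the spectrum of `C`. Cayley-Hamilton
  -- then gives `X * p(C) = p(B) * X = 0`.
  have hunit : IsUnit (aeval C B.charpoly) := by
    by_contra hu
    have hs := IsAlgClosed.splits B.charpoly
    rw [hs.eq_prod_roots_of_monic B.charpoly_monic] at hu
    obtain ⟨k, hk, hk0⟩ := spectrum.exists_mem_of_not_isUnit_aeval_prod hu
    exact Set.disjoint_left.1 hd (Matrix.mem_spectrum_of_isRoot_charpoly hk0) hk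
  have h0 := Matrix.aeval_mul_eq_mul_aeval h B.charpoly
  rw [Matrix.aeval_self_charpoly, zero_mul] at h0
  exact (hunit.mul_left_eq_zero).1 h0.symm

/-- Over `ℂ` the equation intertwines `Aᵀ` and `-A`, whose spectra `σ(A)` and `-σ(A)` are disjoint
exactly by the Sylvester condition. -/
theorem LQG.IsSylvester.eq_zero_of_transpose_mul_add_mul_eq_zero {n : ℕ}
    {A X : Matrix (Fin n) (Fin n) ℝ} (hA : LQG.IsSylvester A) (h : Aᵀ * X + X * A = 0) :
    X = 0 := by
  set B := A.map (algebraMap ℝ ℂ) with hB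
  have hmap : Bᵀ * X.map (algebraMap ℝ ℂ) = X.map (algebraMap ℝ ℂ) * (-B) := by
    have h' := congrArg (fun M => M.map (algebraMap ℝ ℂ)) h
    simp only [Matrix.map_add _ (map_add (algebraMap ℝ ℂ)), Matrix.map_mul,
      Matrix.map_zero _ (map_zero (algebraMap ℝ ℂ)), Matrix.transpose_map] at h'
    rw [mul_neg]
    exact eq_neg_of_add_eq_zero_left h'
  have hd : Disjoint (spectrum ℂ Bᵀ) (spectrum ℂ (-B)) := by
    rw [Set.disjoint_left]
    intro a ha hb
    rw [← spectrum.neg_eq, Set.mem_neg] at hb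
    have ha' : a ∈ spectrum ℂ B := by
      rw [Matrix.mem_spectrum_iff_isRoot_charpoly] at ha ⊢
      rwa [Matrix.charpoly_transpose] at ha
    have key : ∀ c ∈ spectrum ℂ B, Module.End.HasEigenvalue (Matrix.toLin' B) c := by
      intro c hc
      rw [Module.End.hasEigenvalue_iff_mem_spectrum]
      rwa [Matrix.spectrum_toLin']
    exact hA a (-a) (key _ ha') (key _ hb) (neg_neg a).symm
  have h0 := Matrix.eq_zero_of_mul_eq_mul_of_disjoint_spectrum hd hmap
  ext i j
  have := congrFun (congrFun h0 i) j
  simpa using this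

theorem LQG.IsSylvester.existsUnique_isLyapunovBarSolution {n : ℕ}
    {A : Matrix (Fin n) (Fin n) ℝ} (hA : LQG.IsSylvester A) (Q : Matrix (Fin n) (Fin n) ℝ) :
    ∃! X : Matrix (Fin n) (Fin n) ℝ, LQG.IsLyapunovBarSolution A Q X := by
  let Φ : Matrix (Fin n) (Fin n) ℝ →ₗ[ℝ] Matrix (Fin n) (Fin n) ℝ :=
    LinearMap.mulLeft ℝ Aᵀ + LinearMap.mulRight ℝ A
  have hinj : Function.Injective Φ := by
    rw [← LinearMap.ker_eq_bot, LinearMap.ker_eq_bot']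
    intro X hX
    exact hA.eq_zero_of_transpose_mul_add_mul_eq_zero hX
  obtain ⟨X, hX⟩ := (LinearMap.injective_iff_surjective.1 hinj) (-Q)
  have hX' : Aᵀ * X + X * A = -Q := hX
  refine ⟨X, ?_, fun Y hY => hinj ?_⟩
  · simp [LQG.IsLyapunovBarSolution, hX']
  · rw [hX]
    exact eq_neg_of_add_eq_zero_left hY

end Lyapunov

/-! ### Linear integral equations and the differential Lyapunov equation. -/

section Deterministic

/-- A solution of the homogeneous linear integral equation `f t = ∫₀ᵗ L (f s) ds` vanishes. -/
theorem eq_zero_of_eq_integral_clm {E : Type*} [NormedAddCommGroup E] [NormedSpace ℝ E]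
    [CompleteSpace E] (L : E →L[ℝ] E) {f : ℝ → E} {T : ℝ} (hT : 0 ≤ T)
    (hf : IntervalIntegrable f volume 0 T)
    (heq : ∀ t ∈ Set.Icc 0 T, f t = ∫ s in (0 : ℝ)..t, L (f s)) :
    ∀ t ∈ Set.Icc 0 T, f t = 0 := by
  have hLf : IntervalIntegrable (fun s => L (f s)) volume 0 T :=
    ⟨L.integrable_comp hf.1, L.integrable_comp hf.2⟩
  have hfc : ContinuousOn f (Set.Icc 0 T) := by
    have h1 := intervalIntegral.continuousOn_primitive_interval' hLf Set.left_mem_uIcc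
    rw [Set.uIcc_of_le hT] at h1
    exact h1.congr heq
  -- A continuous extension of `f` to the whole line makes the primitive `G` differentiable
  -- everywhere; Gronwall with zero initial value then applies to `G`.
  set g : ℝ → E := Set.IccExtend hT ((Set.Icc 0 T).domRestrict f) with hg
  have hgc : Continuous g := (continuousOn_iff_continuous_domRestrict.1 hfc).Icc_extend'
  have hgf : ∀ t ∈ Set.Icc 0 T, g t = f t := fun t ht => Set.IccExtend_of_mem hT _ ht
  have hLg : Continuous fun s => L (g s) := L.continuous.comp hgc
  set G : ℝ → E := fun t => ∫ s in (0 : ℝ)..t, L (g s) with hG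
  have hGd : ∀ t, HasDerivAt G (L (g t)) t := fun t =>
    hLg.integral_hasStrictDerivAt 0 t |>.hasDerivAt
  have hGf : ∀ t ∈ Set.Icc 0 T, G t = f t := by
    intro t ht
    rw [heq t ht, hG]
    refine intervalIntegral.integral_congr fun s hs => ?_
    rw [Set.uIcc_of_le ht.1] at hs
    simp only [hgf s ⟨hs.1, hs.2.trans ht.2⟩]
  intro t ht
  have hb := norm_le_gronwallBound_of_norm_deriv_right_le (f := G) (f' := fun t => L (g t))
    (δ := 0) (K := ‖L‖) (ε := 0) (a := 0) (b := T)
    (fun s _ => (hGd s).continuousAt.continuousWithinAt) (fun s _ => (hGd s).hasDerivWithinAt)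
    (by simp [hG]) (fun s hs => by
      have hs' := Set.Ico_subset_Icc_self hs
      rw [add_zero, hGf s hs', ← hgf s hs']
      exact L.le_opNorm _) t ht
  rw [← hGf t ht]
  simpa [gronwallBound_ε0_δ0] using hb

/-- A priori bound for a linear integral equation with additive forcing. -/
theorem norm_sq_le_of_eq_integral_clm_add {E : Type*} [NormedAddCommGroup E]
    [InnerProductSpace ℝ E] [CompleteSpace E] (L : E →L[ℝ] E) {x w : ℝ → E}
    (hx : Continuous x) (hw : Continuous w)
    (heq : ∀ t, 0 ≤ t → x t = x 0 + (∫ s in (0 : ℝ)..t, L (x s)) + w t)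
    {t T : ℝ} (ht : 0 ≤ t) (htT : t ≤ T) :
    ‖x t‖ ^ 2 ≤ 2 * (Real.exp (2 * (‖L‖ + 1) * T) *
      (‖x 0‖ ^ 2 + ‖L‖ ^ 2 * ∫ s in (0 : ℝ)..T, ‖w s‖ ^ 2)) + 2 * ‖w t‖ ^ 2 := by
  set k := ‖L‖ + 1 with hk
  have hk0 : 0 ≤ k := by positivity
  set y : ℝ → E := fun t => x 0 + ∫ s in (0 : ℝ)..t, L (x s) with hy
  have hyd : ∀ t, HasDerivAt y (L (x t)) t := fun t =>
    ((L.continuous.comp hx).integral_hasStrictDerivAt 0 t).hasDerivAt.const_add _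
  have hxy : ∀ t, 0 ≤ t → x t = y t + w t := heq
  -- With `x = y + w`, Young's inequality gives `2⟨y, Lx⟩ ≤ (2‖L‖ + 1)‖y‖² + ‖L‖²‖w‖²`, so the rate
  -- `2k = 2‖L‖ + 2` suffices to make `g` nonincreasing.
  set g : ℝ → ℝ := fun t => Real.exp (-(2 * k) * t) * ‖y t‖ ^ 2
    - ‖L‖ ^ 2 * ∫ s in (0 : ℝ)..t, ‖w s‖ ^ 2 with hg
  have hwc : Continuous fun s => ‖w s‖ ^ 2 := hw.norm.pow 2
  have hgd : ∀ t, HasDerivAt g ((Real.exp (-(2 * k) * t) * (-(2 * k) * 1) * ‖y t‖ ^ 2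
      + Real.exp (-(2 * k) * t) * (2 * inner ℝ (y t) (L (x t)))) - ‖L‖ ^ 2 * ‖w t‖ ^ 2) t :=
    fun t => ((((hasDerivAt_id t).const_mul _).exp).mul ((hyd t).norm_sq)).sub
      ((hwc.integral_hasStrictDerivAt 0 t).hasDerivAt.const_mul _)
  have hanti : AntitoneOn g (Set.Ici 0) := by
    refine antitoneOn_of_deriv_nonpos (convex_Ici 0)
      (fun t _ => (hgd t).continuousAt.continuousWithinAt)
      (fun t _ => (hgd t).differentiableAt.differentiableWithinAt) fun t ht => ?_
    rw [interior_Ici] at ht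
    have ht0 : (0 : ℝ) ≤ t := le_of_lt ht
    rw [(hgd t).deriv]
    have h1 : inner ℝ (y t) (L (x t)) ≤ ‖y t‖ * (‖L‖ * (‖y t‖ + ‖w t‖)) := by
      refine (real_inner_le_norm _ _).trans ?_
      gcongr
      refine (L.le_opNorm _).trans ?_
      gcongr
      rw [hxy t ht0]
      exact norm_add_le _ _
    have h2 : 2 * inner ℝ (y t) (L (x t)) - 2 * k * ‖y t‖ ^ 2 ≤ ‖L‖ ^ 2 * ‖w t‖ ^ 2 := by
      rw [hk]
      nlinarith [sq_nonneg (‖y t‖ - ‖L‖ * ‖w t‖), sq_nonneg ‖y t‖]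
    have h3 : Real.exp (-(2 * k) * t) ≤ 1 := Real.exp_le_one_iff.2 (by nlinarith)
    have h4 := Real.exp_pos (-(2 * k) * t)
    have h5 : 0 ≤ ‖L‖ ^ 2 * ‖w t‖ ^ 2 := by positivity
    nlinarith [mul_le_mul_of_nonneg_left h2 h4.le, mul_le_mul_of_nonneg_right h3 h5]
  have hg0 : g t ≤ g 0 := hanti Set.self_mem_Ici ht ht
  have hgz : g 0 = ‖x 0‖ ^ 2 := by simp [hg, hy]
  rw [hgz] at hg0
  have hI : ∫ s in (0 : ℝ)..t, ‖w s‖ ^ 2 ≤ ∫ s in (0 : ℝ)..T, ‖w s‖ ^ 2 :=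
    intervalIntegral.integral_mono_interval le_rfl ht htT
      (Filter.Eventually.of_forall fun s => by positivity) (hwc.intervalIntegrable _ _)
  have hyb : ‖y t‖ ^ 2 ≤ Real.exp (2 * k * T) *
      (‖x 0‖ ^ 2 + ‖L‖ ^ 2 * ∫ s in (0 : ℝ)..T, ‖w s‖ ^ 2) := by
    have h1 : Real.exp (-(2 * k) * t) * ‖y t‖ ^ 2 ≤
        ‖x 0‖ ^ 2 + ‖L‖ ^ 2 * ∫ s in (0 : ℝ)..T, ‖w s‖ ^ 2 := by
      have := mul_le_mul_of_nonneg_left hI (sq_nonneg ‖L‖)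
      simp only [hg] at hg0
      linarith
    have h2 : ‖y t‖ ^ 2 = Real.exp (2 * k * t) * (Real.exp (-(2 * k) * t) * ‖y t‖ ^ 2) := by
      rw [← mul_assoc, ← Real.exp_add]
      simp
    rw [h2]
    have h0 : 0 ≤ Real.exp (-(2 * k) * t) * ‖y t‖ ^ 2 := by positivity
    gcongr
  rw [hxy t ht]
  have := norm_add_le (y t) (w t)
  have h0 := norm_nonneg (y t + w t)
  nlinarith [sq_nonneg (‖y t‖ - ‖w t‖), norm_nonneg (y t), norm_nonneg (w t)]

/-- If `S` solves the integrated differential Lyapunov equation `S' = A S + S Aᵀ + V` and `X` solves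
the algebraic one for `A + α I`, then `∫₀ᵀ e^{2αt} tr (Q S(t)) dt` is given by the boundary values
of `S`. -/
theorem LQG.IsLyapunovBarSolution.integral_exp_mul_trace {n : ℕ}
    {A V Q X : Matrix (Fin n) (Fin n) ℝ} {α : ℝ} (hα : α ≠ 0)
    (hX : LQG.IsLyapunovBarSolution (LQG.shifted A α) Q X)
    {S : ℝ → Matrix (Fin n) (Fin n) ℝ} {T : ℝ} (hT : 0 ≤ T)
    (hint : ∀ i j, IntervalIntegrable (fun t => S t i j) volume 0 T)
    (hS : ∀ t ∈ Set.Icc 0 T, ∀ i j,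
      S t i j = S 0 i j + (∫ s in (0 : ℝ)..t, (A * S s + S s * Aᵀ) i j) + t * V i j) :
    ∫ t in (0 : ℝ)..T, Real.exp (2 * α * t) * (Q * S t).trace =
      ((S 0 - Real.exp (2 * α * T) • S T
        + (1 - Real.exp (2 * α * T)) • ((2 * α)⁻¹ • (-V))) * X).trace := by
  have hg : ∀ i j, IntervalIntegrable (fun t => (A * S t + S t * Aᵀ) i j) volume 0 T := by
    intro i j
    simp only [Matrix.add_apply, Matrix.mul_apply]
    refine IntervalIntegrable.add ?_ ?_
    · simpa only [Finset.sum_fn] using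
        IntervalIntegrable.sum Finset.univ fun k _ => (hint k j).const_mul (A i k)
    · simpa only [Finset.sum_fn] using
        IntervalIntegrable.sum Finset.univ fun k _ => (hint i k).mul_const (Aᵀ k j)
  -- The integral equation bootstraps regularity: integrable entries give a continuous `S`, hence a
  -- differentiable one inside the interval.
  have hSc : ContinuousOn S (Set.Icc 0 T) := by
    refine continuousOn_pi.2 fun i => continuousOn_pi.2 fun j => ?_
    have h1 := intervalIntegral.continuousOn_primitive_interval' (hg i j) Set.left_mem_uIcc
    rw [Set.uIcc_of_le hT] at h1
    refine ContinuousOn.congr ?_ fun t ht => hS t ht i j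
    exact (continuousOn_const.add h1).add (continuousOn_id.mul continuousOn_const)
  have hgc : ContinuousOn (fun t => A * S t + S t * Aᵀ) (Set.Icc 0 T) :=
    ((continuous_const.matrix_mul continuous_id).add
      (continuous_id.matrix_mul continuous_const)).comp_continuousOn hSc
  have hSd : ∀ t ∈ Set.Ioo 0 T, ∀ i j,
      HasDerivAt (fun t => S t i j) ((A * S t + S t * Aᵀ + V) i j) t := by
    intro t ht i j
    have hc : ContinuousOn (fun t => (A * S t + S t * Aᵀ) i j) (Set.Icc 0 T) :=
      (continuous_apply_apply i j).comp_continuousOn hgc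
    have hnhds : Set.Icc 0 T ∈ nhds t := Icc_mem_nhds ht.1 ht.2
    have hd := intervalIntegral.integral_hasDerivAt_right
      ((hg i j).mono_set (Set.uIcc_subset_uIcc Set.left_mem_uIcc (by
        rw [Set.uIcc_of_le hT]; exact Set.Ioo_subset_Icc_self ht)))
      (hc.stronglyMeasurableAtFilter_nhdsWithin measurableSet_Icc t |>.filter_mono
        (by rw [nhdsWithin_eq_nhds.2 hnhds])) (hc.continuousAt hnhds)
    have hd' := ((hd.const_add (S 0 i j)).add ((hasDerivAt_id t).mul_const (V i j)))
    rw [one_mul] at hd'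
    refine hd'.congr_of_eventuallyEq ?_
    filter_upwards [hnhds] with s hs using hS s hs i j
  set φ : ℝ → ℝ := fun t => (S t * X).trace with hφ
  have hφc : ContinuousOn φ (Set.Icc 0 T) :=
    (continuous_id.matrix_mul continuous_const).matrix_trace.comp_continuousOn hSc
  have hφd : ∀ t ∈ Set.Ioo 0 T, HasDerivAt φ (((A * S t + S t * Aᵀ + V) * X).trace) t := by
    intro t ht
    simp only [hφ, Matrix.trace, Matrix.diag, Matrix.mul_apply (N := X)]
    exact HasDerivAt.fun_sum fun i _ => HasDerivAt.fun_sum fun j _ => (hSd t ht i j).mul_const _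
  -- The Lyapunov equation is paired with `S t` under the trace; cyclicity matches the terms, and
  -- the shift by `α` yields `2αφ`.
  have hLyap : ∀ t, ((A * S t + S t * Aᵀ + V) * X).trace + 2 * α * φ t
      = - (Q * S t).trace + (V * X).trace := by
    intro t
    have h := congrArg (fun M => (M * S t).trace) hX
    simp only [LQG.shifted, Matrix.transpose_add, Matrix.transpose_smul, Matrix.transpose_one,
      add_mul, mul_add, Matrix.smul_mul, Matrix.mul_smul, Matrix.one_mul, Matrix.mul_one,
      Matrix.trace_add, Matrix.trace_smul, Matrix.zero_mul, Matrix.trace_zero, smul_eq_mul] at h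
    simp only [hφ, add_mul, Matrix.trace_add]
    have e1 : (A * S t * X).trace = (X * A * S t).trace := by
      rw [Matrix.trace_mul_comm, ← Matrix.mul_assoc]
    have e2 : (S t * Aᵀ * X).trace = (Aᵀ * X * S t).trace := by
      rw [Matrix.mul_assoc, Matrix.trace_mul_comm]
    have e3 : (S t * X).trace = (X * S t).trace := Matrix.trace_mul_comm _ _
    rw [e1, e2, e3]
    linarith
  -- An antiderivative of the integrand; the constant `(2α)⁻¹ tr(VX)` absorbs the noise
  -- contribution.
  set F : ℝ → ℝ := fun t =>
    Real.exp (2 * α * t) * ((2 * α)⁻¹ * (V * X).trace - φ t) with hF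
  have hexp : Continuous fun t : ℝ => Real.exp (2 * α * t) := by fun_prop
  have hFc : ContinuousOn F (Set.Icc 0 T) :=
    hexp.continuousOn.mul (continuousOn_const.sub hφc)
  have hFd : ∀ t ∈ Set.Ioo 0 T,
      HasDerivAt F (Real.exp (2 * α * t) * (Q * S t).trace) t := by
    intro t ht
    have h1 := (((hasDerivAt_id t).const_mul (2 * α)).exp).mul
      ((hφd t ht).const_sub ((2 * α)⁻¹ * (V * X).trace))
    refine h1.congr_deriv ?_
    have h2 := hLyap t
    have h4 : (Q * S t).trace =
        (V * X).trace - ((A * S t + S t * Aᵀ + V) * X).trace - 2 * α * φ t := by linarith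
    rw [h4]
    simp only [id]
    field_simp
    ring
  have hcont : ContinuousOn (fun t => Real.exp (2 * α * t) * (Q * S t).trace)
      (Set.Icc 0 T) :=
    hexp.continuousOn.mul
      ((continuous_const.matrix_mul continuous_id).matrix_trace.comp_continuousOn hSc)
  rw [intervalIntegral.integral_eq_sub_of_hasDerivAt_of_le hT hFc hFd
    (hcont.intervalIntegrable_of_Icc hT)]
  simp only [hF, hφ, add_mul, sub_mul, Matrix.smul_mul, Matrix.neg_mul, Matrix.trace_add,
    Matrix.trace_sub, Matrix.trace_smul, Matrix.trace_neg, smul_eq_mul, mul_zero, Real.exp_zero]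
  ring

end Deterministic

/-! ### Fubini for time integrals of processes. -/

section ExpectationOfTimeIntegral

variable {Ω : Type*} [MeasurableSpace Ω] {P : Measure Ω} [IsProbabilityMeasure P]

theorem integrable_intervalIntegral_of_integrable_prod {F : ℝ → Ω → ℝ} {t : ℝ} (ht : 0 ≤ t)
    (hF : Integrable (Function.uncurry F) ((volume.restrict (Set.Ioc 0 t)).prod P)) :
    Integrable (fun ω => ∫ s in (0 : ℝ)..t, F s ω) P := by
  simp only [intervalIntegral.integral_of_le ht]
  exact hF.integral_prod_right

theorem intervalIntegrable_integral_of_integrable_prod {F : ℝ → Ω → ℝ} {t : ℝ} (ht : 0 ≤ t)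
    (hF : Integrable (Function.uncurry F) ((volume.restrict (Set.Ioc 0 t)).prod P)) :
    IntervalIntegrable (fun s => ∫ ω, F s ω ∂P) volume 0 t := by
  rw [intervalIntegrable_iff_integrableOn_Ioc_of_le ht]
  exact hF.integral_prod_left

theorem integral_intervalIntegral_of_integrable_prod {F : ℝ → Ω → ℝ} {t : ℝ} (ht : 0 ≤ t)
    (hF : Integrable (Function.uncurry F) ((volume.restrict (Set.Ioc 0 t)).prod P)) :
    ∫ ω, (∫ s in (0 : ℝ)..t, F s ω) ∂P = ∫ s in (0 : ℝ)..t, (∫ ω, F s ω ∂P) := by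
  simp only [intervalIntegral.integral_of_le ht]
  exact (integral_integral_swap hF).symm

end ExpectationOfTimeIntegral

/-! ### Square integrability of regular solutions. -/

namespace LQG

/-- A version of a solution of `dx = A x dt + dw`, indexed by real times, for which path regularity
and the integral equation hold for every sample point, together with the second-order data of the
initial state and the noise. -/
structure IsRegularSolution {n : ℕ} {Ω : Type*} [MeasurableSpace Ω]
    (A V : Matrix (Fin n) (Fin n) ℝ) (X W : ℝ → Ω → EuclideanSpace ℝ (Fin n))
    (P : Measure Ω) : Prop where
  measurable_state : ∀ t, Measurable (X t)
  continuous_state : ∀ ω, Continuous fun t => X t ω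
  measurable_noise : ∀ t, Measurable (W t)
  continuous_noise : ∀ ω, Continuous fun t => W t ω
  integral_eq : ∀ ω t, 0 ≤ t →
    X t ω = X 0 ω + (∫ s in (0 : ℝ)..t, Matrix.toEuclideanCLM (𝕜 := ℝ) A (X s ω)) + W t ω
  memLp_initial : MemLp (X 0) 2 P
  memLp_noise : ∀ t, 0 ≤ t → MemLp (W t) 2 P
  integral_noise_mul_noise : ∀ s t, 0 ≤ s → s ≤ t → ∀ i j,
    ∫ ω, W s ω i * W t ω j ∂P = s * V i j
  integral_initial_mul_noise : ∀ t, 0 ≤ t → ∀ i j, ∫ ω, X 0 ω i * W t ω j ∂P = 0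

namespace IsRegularSolution

variable {n : ℕ} {Ω : Type*} [MeasurableSpace Ω] {P : Measure Ω}
  {A V : Matrix (Fin n) (Fin n) ℝ} {X W : ℝ → Ω → EuclideanSpace ℝ (Fin n)}

theorem measurable_uncurry_state (h : IsRegularSolution A V X W P) :
    Measurable (Function.uncurry X) :=
  measurable_uncurry_of_continuous_of_measurable h.continuous_state h.measurable_state

theorem measurable_uncurry_noise (h : IsRegularSolution A V X W P) :
    Measurable (Function.uncurry W) :=
  measurable_uncurry_of_continuous_of_measurable h.continuous_noise h.measurable_noise

theorem integral_norm_sq_noise (h : IsRegularSolution A V X W P) {t : ℝ} (ht : 0 ≤ t) :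
    ∫ ω, ‖W t ω‖ ^ 2 ∂P = t * V.trace := by
  simp only [EuclideanSpace.real_norm_sq_eq]
  rw [integral_finsetSum _ fun i _ => ((h.memLp_noise t ht).eval_piLp i).integrable_sq]
  simp only [pow_two, h.integral_noise_mul_noise t t ht le_rfl, ← Finset.mul_sum]
  rfl

theorem continuous_drift (h : IsRegularSolution A V X W P) (ω : Ω) (i : Fin n) :
    Continuous fun s => ∑ k, A i k * X s ω k :=
  continuous_finsetSum _ fun k _ =>
    ((EuclideanSpace.proj (𝕜 := ℝ) k).continuous.comp (h.continuous_state ω)).const_mul _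

theorem eval_integral_eq (h : IsRegularSolution A V X W P) (ω : Ω) {t : ℝ} (ht : 0 ≤ t)
    (i : Fin n) :
    X t ω i = X 0 ω i + (∫ s in (0 : ℝ)..t, ∑ k, A i k * X s ω k) + W t ω i := by
  have h1 := congrArg (EuclideanSpace.proj (𝕜 := ℝ) i) (h.integral_eq ω t ht)
  have hi : IntervalIntegrable (fun s => Matrix.toEuclideanCLM (𝕜 := ℝ) A (X s ω)) volume 0 t :=
    ((Matrix.toEuclideanCLM (𝕜 := ℝ) A).continuous.comp
      (h.continuous_state ω)).intervalIntegrable _ _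
  rw [map_add, map_add, ← ContinuousLinearMap.intervalIntegral_comp_comm _ hi] at h1
  simpa [Matrix.ofLp_toEuclideanCLM, Matrix.mulVec, dotProduct] using h1

variable [IsProbabilityMeasure P]

theorem integrable_norm_sq_noise_prod (h : IsRegularSolution A V X W P) (T : ℝ) :
    Integrable (Function.uncurry fun t ω => ‖W t ω‖ ^ 2)
      ((volume.restrict (Set.Ioc 0 T)).prod P) := by
  have hm : Measurable (Function.uncurry fun t ω => ‖W t ω‖ ^ 2) :=
    (h.measurable_uncurry_noise.norm.pow_const 2)
  rw [integrable_prod_iff hm.aestronglyMeasurable]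
  constructor
  · filter_upwards [ae_restrict_mem measurableSet_Ioc] with t ht
    exact (h.memLp_noise t ht.1.le).norm.integrable_sq
  · have hi : Integrable (fun t : ℝ => t * V.trace) (volume.restrict (Set.Ioc 0 T)) :=
      (Continuous.integrableOn_Ioc (by fun_prop))
    refine hi.congr ?_
    filter_upwards [ae_restrict_mem measurableSet_Ioc] with t ht
    rw [← h.integral_norm_sq_noise ht.1.le]
    simp [Function.uncurry]

theorem memLp_noise_prod (h : IsRegularSolution A V X W P) (T : ℝ) :
    MemLp (Function.uncurry W) 2 ((volume.restrict (Set.Ioc 0 T)).prod P) :=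
  (memLp_two_iff_integrable_sq_norm h.measurable_uncurry_noise.aestronglyMeasurable).2
    (h.integrable_norm_sq_noise_prod T)

theorem integrable_initial_add_noise (h : IsRegularSolution A V X W P) {T : ℝ} (hT : 0 ≤ T)
    (c d : ℝ) : Integrable (fun ω => 2 * (c *
      (‖X 0 ω‖ ^ 2 + d * ∫ s in (0 : ℝ)..T, ‖W s ω‖ ^ 2))) P :=
  (((h.memLp_initial.norm.integrable_sq).add
    ((integrable_intervalIntegral_of_integrable_prod hT
      (h.integrable_norm_sq_noise_prod T)).const_mul _)).const_mul _).const_mul _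

theorem memLp_state (h : IsRegularSolution A V X W P) {t : ℝ} (ht : 0 ≤ t) :
    MemLp (X t) 2 P := by
  rw [memLp_two_iff_integrable_sq_norm (h.measurable_state t).aestronglyMeasurable]
  refine ((h.integrable_initial_add_noise ht
      (Real.exp (2 * (‖Matrix.toEuclideanCLM (𝕜 := ℝ) A‖ + 1) * t))
      (‖Matrix.toEuclideanCLM (𝕜 := ℝ) A‖ ^ 2)).add
    ((h.memLp_noise t ht).norm.integrable_sq.const_mul 2)).mono'
    ((h.measurable_state t).norm.pow_const 2).aestronglyMeasurable
    (Filter.Eventually.of_forall fun ω => ?_)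
  rw [Real.norm_of_nonneg (by positivity)]
  exact norm_sq_le_of_eq_integral_clm_add _ (h.continuous_state ω) (h.continuous_noise ω)
    (h.integral_eq ω) ht le_rfl

/-- In the pathwise bound only the term `2‖w t‖²` depends on `t`; the rest is a single integrable
random variable for all times up to `T`, so the bound dominates on the product space. -/
theorem memLp_state_prod (h : IsRegularSolution A V X W P) (T : ℝ) :
    MemLp (Function.uncurry X) 2 ((volume.restrict (Set.Ioc 0 T)).prod P) := by
  rcases le_or_gt T 0 with hT | hT
  · rw [Set.Ioc_eq_empty hT.not_gt]
    simp
  rw [memLp_two_iff_integrable_sq_norm h.measurable_uncurry_state.aestronglyMeasurable]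
  have hae : ∀ᵐ p : ℝ × Ω ∂((volume.restrict (Set.Ioc 0 T)).prod P), p.1 ∈ Set.Ioc 0 T :=
    Measure.quasiMeasurePreserving_fst.ae (ae_restrict_mem measurableSet_Ioc)
  refine (((h.integrable_initial_add_noise hT.le
      (Real.exp (2 * (‖Matrix.toEuclideanCLM (𝕜 := ℝ) A‖ + 1) * T))
      (‖Matrix.toEuclideanCLM (𝕜 := ℝ) A‖ ^ 2)).comp_snd _).add
    ((h.integrable_norm_sq_noise_prod T).const_mul 2)).mono'
    (h.measurable_uncurry_state.norm.pow_const 2).aestronglyMeasurable ?_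
  filter_upwards [hae] with p hp
  rw [Real.norm_of_nonneg (by positivity)]
  exact norm_sq_le_of_eq_integral_clm_add _ (h.continuous_state p.2) (h.continuous_noise p.2)
    (h.integral_eq p.2) hp.1.le hp.2

theorem memLp_drift (h : IsRegularSolution A V X W P) {t : ℝ} (ht : 0 ≤ t) (i : Fin n) :
    MemLp (fun ω => ∑ k, A i k * X t ω k) 2 P :=
  memLp_finsetSum _ fun k _ => ((h.memLp_state ht).eval_piLp k).const_mul _

theorem memLp_drift_prod (h : IsRegularSolution A V X W P) (T : ℝ) (i : Fin n) :
    MemLp (Function.uncurry fun t ω => ∑ k, A i k * X t ω k) 2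
      ((volume.restrict (Set.Ioc 0 T)).prod P) :=
  memLp_finsetSum _ fun k _ => ((h.memLp_state_prod T).eval_piLp k).const_mul _

end IsRegularSolution

end LQG

theorem MeasureTheory.MemLp.integrable_fun_mul {α : Type*} [MeasurableSpace α] {μ : Measure α}
    {f g : α → ℝ} (hf : MemLp f 2 μ) (hg : MemLp g 2 μ) :
    Integrable (fun a => f a * g a) μ :=
  hf.integrable_mul hg

theorem MeasureTheory.MemLp.fun_sub_apply {α : Type*} [MeasurableSpace α] {μ : Measure α}
    {f g : α → ℝ} (hf : MemLp f 2 μ) (hg : MemLp g 2 μ) :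
    MemLp (fun a => f a - g a) 2 μ :=
  hf.sub hg

/-! ### Moment equations and the expected cost. -/

namespace LQG

namespace IsRegularSolution

variable {n : ℕ} {Ω : Type*} [MeasurableSpace Ω] {P : Measure Ω}
  {A V : Matrix (Fin n) (Fin n) ℝ} {X W : ℝ → Ω → EuclideanSpace ℝ (Fin n)}

/-- The product rule for the differentiable part `X - W` of the state. -/
theorem sub_noise_mul_sub_noise (h : IsRegularSolution A V X W P) (ω : Ω) {t : ℝ}
    (ht : 0 ≤ t) (i j : Fin n) :
    (X t ω i - W t ω i) * (X t ω j - W t ω j) = X 0 ω i * X 0 ω j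
      + ∫ s in (0 : ℝ)..t, ((∑ k, A i k * X s ω k) * (X s ω j - W s ω j)
        + (X s ω i - W s ω i) * ∑ k, A j k * X s ω k) := by
  set u : Fin n → ℝ → ℝ := fun i t => X 0 ω i + ∫ s in (0 : ℝ)..t, ∑ k, A i k * X s ω k with hu
  have hud : ∀ i t, HasDerivAt (u i) (∑ k, A i k * X t ω k) t := fun i t =>
    ((h.continuous_drift ω i).integral_hasStrictDerivAt 0 t).hasDerivAt.const_add _
  have hxu : ∀ i t, 0 ≤ t → X t ω i - W t ω i = u i t := fun i t ht => by
    rw [h.eval_integral_eq ω ht i, add_sub_cancel_right]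
  have h1 := intervalIntegral.integral_deriv_mul_eq_sub (a := 0) (b := t)
    (fun s _ => hud i s) (fun s _ => hud j s)
    ((h.continuous_drift ω i).intervalIntegrable _ _)
    ((h.continuous_drift ω j).intervalIntegrable _ _)
  have h2 : ∫ s in (0 : ℝ)..t, ((∑ k, A i k * X s ω k) * (X s ω j - W s ω j)
        + (X s ω i - W s ω i) * ∑ k, A j k * X s ω k)
      = ∫ s in (0 : ℝ)..t, ((∑ k, A i k * X s ω k) * u j s + u i s * ∑ k, A j k * X s ω k) := by
    refine intervalIntegral.integral_congr fun s hs => ?_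
    rw [Set.uIcc_of_le ht] at hs
    simp only [hxu _ s hs.1]
  rw [h2, h1, hxu i t ht, hxu j t ht]
  simp [hu]

variable [IsProbabilityMeasure P]

theorem intervalIntegrable_integral_state_mul (h : IsRegularSolution A V X W P) {t : ℝ}
    (ht : 0 ≤ t) {Z : Ω → ℝ} (hZ : MemLp Z 2 P) (i : Fin n) :
    IntervalIntegrable (fun s => ∫ ω, X s ω i * Z ω ∂P) volume 0 t :=
  intervalIntegrable_integral_of_integrable_prod ht (F := fun s ω => X s ω i * Z ω)
    (((h.memLp_state_prod t).eval_piLp i).integrable_fun_mul (hZ.comp_snd _))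

theorem integral_drift_mul (h : IsRegularSolution A V X W P) {t : ℝ} (ht : 0 ≤ t)
    {Z : Ω → ℝ} (hZ : MemLp Z 2 P) (i : Fin n) :
    ∫ ω, (∑ k, A i k * X t ω k) * Z ω ∂P = ∑ k, A i k * ∫ ω, X t ω k * Z ω ∂P := by
  simp only [Finset.sum_mul, mul_assoc]
  rw [integral_finsetSum _ fun k _ =>
    (((h.memLp_state ht).eval_piLp k).integrable_fun_mul hZ).const_mul (A i k)]
  simp only [integral_const_mul]

/-- The integral equation tested against a square integrable random variable. -/
theorem integral_state_mul (h : IsRegularSolution A V X W P) {t : ℝ} (ht : 0 ≤ t)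
    {Z : Ω → ℝ} (hZ : MemLp Z 2 P) (i : Fin n) :
    ∫ ω, X t ω i * Z ω ∂P = ∫ ω, X 0 ω i * Z ω ∂P
      + (∫ s in (0 : ℝ)..t, ∑ k, A i k * ∫ ω, X s ω k * Z ω ∂P) + ∫ ω, W t ω i * Z ω ∂P := by
  have hF : Integrable (Function.uncurry fun s ω => (∑ k, A i k * X s ω k) * Z ω)
      ((volume.restrict (Set.Ioc 0 t)).prod P) :=
    (h.memLp_drift_prod t i).integrable_fun_mul (hZ.comp_snd _)
  have h0 := ((h.memLp_initial.eval_piLp i).integrable_fun_mul hZ)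
  have hW := (((h.memLp_noise t ht).eval_piLp i).integrable_fun_mul hZ)
  have hI := integrable_intervalIntegral_of_integrable_prod ht hF
  have e : ∀ ω, X t ω i * Z ω = X 0 ω i * Z ω
      + (∫ s in (0 : ℝ)..t, (∑ k, A i k * X s ω k) * Z ω) + W t ω i * Z ω := by
    intro ω
    rw [intervalIntegral.integral_mul_const, h.eval_integral_eq ω ht i]
    ring
  simp only [e]
  rw [integral_add (h0.fun_add hI) hW, integral_add h0 hI,
    integral_intervalIntegral_of_integrable_prod ht hF]
  congr 2
  refine intervalIntegral.integral_congr fun s hs => ?_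
  rw [Set.uIcc_of_le ht] at hs
  exact h.integral_drift_mul hs.1 hZ i

/-- The state is uncorrelated with future noise increments. -/
theorem integral_state_mul_noise_eq (h : IsRegularSolution A V X W P) {s t : ℝ} (hs : 0 ≤ s)
    (hst : s ≤ t) (i j : Fin n) :
    ∫ ω, X s ω i * W t ω j ∂P = ∫ ω, X s ω i * W s ω j ∂P := by
  have ht := hs.trans hst
  have hWt := (h.memLp_noise t ht).eval_piLp j
  have hWs := (h.memLp_noise s hs).eval_piLp j
  have hZ : MemLp (fun ω => W t ω j - W s ω j) 2 P := hWt.sub hWs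
  have hsplit : ∀ {Y : Ω → ℝ}, MemLp Y 2 P → ∫ ω, Y ω * (W t ω j - W s ω j) ∂P
      = ∫ ω, Y ω * W t ω j ∂P - ∫ ω, Y ω * W s ω j ∂P := by
    intro Y hY
    simp only [mul_sub]
    exact integral_sub (hY.integrable_fun_mul hWt) (hY.integrable_fun_mul hWs)
  -- On `[0, s]` the vector `r ↦ E[X_r (W_t - W_s)_j]` solves a homogeneous equation: the initial
  -- term vanishes, and the forcing is `r V - r V = 0` because `r ≤ s ≤ t`.
  have key := eq_zero_of_eq_integral_clm (LinearMap.toContinuousLinearMap (Matrix.toLin' A))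
    (f := fun r i => ∫ ω, X r ω i * (W t ω j - W s ω j) ∂P) hs ?_ ?_ s
    (Set.right_mem_Icc.2 hs)
  · have := congrFun key i
    rw [hsplit ((h.memLp_state hs).eval_piLp i)] at this
    exact sub_eq_zero.1 this
  · rw [intervalIntegrable_iff_integrableOn_Ioc_of_le hs]
    exact Integrable.of_eval fun i =>
      (intervalIntegrable_iff_integrableOn_Ioc_of_le hs).1
        (h.intervalIntegrable_integral_state_mul hs hZ i)
  · intro r hr
    ext i
    rw [h.integral_state_mul hr.1 hZ i, hsplit (h.memLp_initial.eval_piLp i),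
      hsplit ((h.memLp_noise r hr.1).eval_piLp i), h.integral_initial_mul_noise t ht,
      h.integral_initial_mul_noise s hs, h.integral_noise_mul_noise r t hr.1 (hr.2.trans hst),
      h.integral_noise_mul_noise r s hr.1 hr.2]
    simp only [sub_self, zero_add, add_zero]
    rw [intervalIntegral.integral_of_le hr.1, intervalIntegral.integral_of_le hr.1, eval_integral]
    · rfl
    · intro k
      refine (intervalIntegrable_iff_integrableOn_Ioc_of_le hr.1).1 ?_
      have : ∀ q, (LinearMap.toContinuousLinearMap (Matrix.toLin' A))
          (fun i => ∫ ω, X q ω i * (W t ω j - W s ω j) ∂P) k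
          = ∑ l, A k l * ∫ ω, X q ω l * (W t ω j - W s ω j) ∂P := fun q => rfl
      simp only [this]
      simpa only [Finset.sum_fn] using IntervalIntegrable.sum Finset.univ fun l _ =>
        (h.intervalIntegrable_integral_state_mul hr.1 hZ l).const_mul (A k l)

theorem intervalIntegrable_integral_state_mul_noise (h : IsRegularSolution A V X W P) {t : ℝ}
    (ht : 0 ≤ t) (i j : Fin n) :
    IntervalIntegrable (fun s => ∫ ω, X s ω i * W s ω j ∂P) volume 0 t :=
  intervalIntegrable_integral_of_integrable_prod ht (F := fun s ω => X s ω i * W s ω j)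
    (((h.memLp_state_prod t).eval_piLp i).integrable_fun_mul ((h.memLp_noise_prod t).eval_piLp j))

theorem intervalIntegrable_integral_state_mul_state (h : IsRegularSolution A V X W P) {t : ℝ}
    (ht : 0 ≤ t) (i j : Fin n) :
    IntervalIntegrable (fun s => ∫ ω, X s ω i * X s ω j ∂P) volume 0 t :=
  intervalIntegrable_integral_of_integrable_prod ht (F := fun s ω => X s ω i * X s ω j)
    (((h.memLp_state_prod t).eval_piLp i).integrable_fun_mul ((h.memLp_state_prod t).eval_piLp j))

/-- Testing against `W t` produces `E[X_s W_t]` under the integral; decorrelation from future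
increments replaces it by `E[X_s W_s]`, which closes the equation. -/
theorem integral_state_mul_noise (h : IsRegularSolution A V X W P) {t : ℝ} (ht : 0 ≤ t)
    (i j : Fin n) :
    ∫ ω, X t ω i * W t ω j ∂P
      = (∫ s in (0 : ℝ)..t, ∑ k, A i k * ∫ ω, X s ω k * W s ω j ∂P) + t * V i j := by
  rw [h.integral_state_mul ht ((h.memLp_noise t ht).eval_piLp j),
    h.integral_initial_mul_noise t ht, h.integral_noise_mul_noise t t ht le_rfl, zero_add]
  congr 1
  refine intervalIntegral.integral_congr fun s hs => ?_
  rw [Set.uIcc_of_le ht] at hs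
  simp only [h.integral_state_mul_noise_eq hs.1 hs.2]

/-- The second moments satisfy the integrated differential Lyapunov equation. -/
theorem integral_state_mul_state (h : IsRegularSolution A V X W P) {t : ℝ} (ht : 0 ≤ t)
    (i j : Fin n) :
    ∫ ω, X t ω i * X t ω j ∂P = ∫ ω, X 0 ω i * X 0 ω j ∂P
      + (∫ s in (0 : ℝ)..t, ((∑ k, A i k * ∫ ω, X s ω k * X s ω j ∂P)
        + ∑ k, A j k * ∫ ω, X s ω i * X s ω k ∂P)) + t * V i j := by
  have hF : Integrable (Function.uncurry fun s ω =>
      (∑ k, A i k * X s ω k) * (X s ω j - W s ω j)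
        + (X s ω i - W s ω i) * ∑ k, A j k * X s ω k)
      ((volume.restrict (Set.Ioc 0 t)).prod P) := by
    have hX := fun l => (h.memLp_state_prod t).eval_piLp l
    have hW := fun l => (h.memLp_noise_prod t).eval_piLp l
    exact ((h.memLp_drift_prod t i).integrable_fun_mul ((hX j).sub (hW j))).add
      (((hX i).sub (hW i)).integrable_fun_mul (h.memLp_drift_prod t j))
  have hE := congrArg (fun f : Ω → ℝ => ∫ ω, f ω ∂P)
    (funext fun ω => h.sub_noise_mul_sub_noise ω ht i j)
  have hx := fun (s : ℝ) (hs : 0 ≤ s) l => (h.memLp_state hs).eval_piLp l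
  have hw := fun (s : ℝ) (hs : 0 ≤ s) l => (h.memLp_noise s hs).eval_piLp l
  have hsub : ∀ s, 0 ≤ s → ∀ {Y : Ω → ℝ}, MemLp Y 2 P → ∀ l,
      ∫ ω, Y ω * (X s ω l - W s ω l) ∂P
        = ∫ ω, Y ω * X s ω l ∂P - ∫ ω, Y ω * W s ω l ∂P := by
    intro s hs Y hY l
    simp only [mul_sub]
    exact integral_sub (hY.integrable_fun_mul (hx s hs l)) (hY.integrable_fun_mul (hw s hs l))
  have hcomm : ∀ f g : Ω → ℝ, ∫ ω, f ω * g ω ∂P = ∫ ω, g ω * f ω ∂P := fun f g => by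
    simp only [mul_comm]
  have hLHS : ∫ ω, (X t ω i - W t ω i) * (X t ω j - W t ω j) ∂P
      = ∫ ω, X t ω i * X t ω j ∂P - ∫ ω, X t ω i * W t ω j ∂P
        - ∫ ω, X t ω j * W t ω i ∂P + t * V i j := by
    rw [hsub t ht ((hx t ht i).fun_sub_apply (hw t ht i)), hcomm, hsub t ht (hx t ht j),
      hcomm (fun ω => X t ω i - W t ω i), hsub t ht (hw t ht j),
      hcomm (fun ω => X t ω j), hcomm (fun ω => W t ω j),
      hcomm (fun ω => W t ω j), h.integral_noise_mul_noise t t ht le_rfl]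
    ring
  have hRHS : ∀ s ∈ Set.uIcc 0 t, ∫ ω, ((∑ k, A i k * X s ω k) * (X s ω j - W s ω j)
        + (X s ω i - W s ω i) * ∑ k, A j k * X s ω k) ∂P
      = ((∑ k, A i k * ∫ ω, X s ω k * X s ω j ∂P) + ∑ k, A j k * ∫ ω, X s ω i * X s ω k ∂P)
        - ((∑ k, A i k * ∫ ω, X s ω k * W s ω j ∂P)
          + ∑ k, A j k * ∫ ω, X s ω k * W s ω i ∂P) := by
    intro s hs
    rw [Set.uIcc_of_le ht] at hs
    have hs := hs.1
    have hd := fun l => h.memLp_drift hs l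
    rw [integral_add (f := fun ω => (∑ k, A i k * X s ω k) * (X s ω j - W s ω j))
      (g := fun ω => (X s ω i - W s ω i) * ∑ k, A j k * X s ω k) ((hd i).integrable_fun_mul ((hx s hs j).fun_sub_apply (hw s hs j)))
      (((hx s hs i).fun_sub_apply (hw s hs i)).integrable_fun_mul (hd j)),
      hcomm (fun ω => X s ω i - W s ω i), hsub s hs (hd i), hsub s hs (hd j),
      h.integral_drift_mul hs (hx s hs j), h.integral_drift_mul hs (hw s hs j),
      h.integral_drift_mul hs (hx s hs i), h.integral_drift_mul hs (hw s hs i)]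
    simp only [hcomm (fun ω => X s ω i)]
    ring
  have hxx := fun a b => h.intervalIntegrable_integral_state_mul_state ht a b
  have hxw := fun a b => h.intervalIntegrable_integral_state_mul_noise ht a b
  have hsum : ∀ (c : Fin n → ℝ) (f : Fin n → ℝ → ℝ),
      (∀ k, IntervalIntegrable (f k) volume 0 t) →
      IntervalIntegrable (fun s => ∑ k, c k * f k s) volume 0 t := by
    intro c f hf
    simpa only [Finset.sum_fn] using
      IntervalIntegrable.sum Finset.univ fun k _ => (hf k).const_mul (c k)
  have h0 := (h.memLp_initial.eval_piLp i).integrable_fun_mul (h.memLp_initial.eval_piLp j)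
  have hVs : t * V j i = t * V i j := by
    rw [← h.integral_noise_mul_noise t t ht le_rfl, ← h.integral_noise_mul_noise t t ht le_rfl,
      hcomm]
  -- The drift integrals of the cross moments cancel. The left side carries `-2tV` from them and
  -- `+tV` from the noise, which leaves `+tV` on the right.
  rw [hLHS, integral_add h0 (integrable_intervalIntegral_of_integrable_prod ht hF),
    integral_intervalIntegral_of_integrable_prod ht hF, intervalIntegral.integral_congr hRHS,
    intervalIntegral.integral_sub
      ((hsum _ _ fun k => hxx k j).add (hsum _ _ fun k => hxx i k))
      ((hsum _ _ fun k => hxw k j).add (hsum _ _ fun k => hxw k i)),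
    intervalIntegral.integral_add (hsum _ _ fun k => hxw k j) (hsum _ _ fun k => hxw k i),
    h.integral_state_mul_noise ht i j, h.integral_state_mul_noise ht j i, hVs] at hE
  linarith

theorem integrable_exp_mul_quadratic_prod (h : IsRegularSolution A V X W P) (α T : ℝ)
    (Q : Matrix (Fin n) (Fin n) ℝ) :
    Integrable (Function.uncurry fun t ω =>
      Real.exp (2 * α * t) * ((X t ω).ofLp ⬝ᵥ Q *ᵥ (X t ω).ofLp))
      ((volume.restrict (Set.Ioc 0 T)).prod P) := by
  have hX := fun l => (h.memLp_state_prod T).eval_piLp l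
  have hq : Integrable (Function.uncurry fun t ω => (X t ω).ofLp ⬝ᵥ Q *ᵥ (X t ω).ofLp)
      ((volume.restrict (Set.Ioc 0 T)).prod P) :=
    integrable_finsetSum Finset.univ fun i _ => (hX i).integrable_fun_mul
      (memLp_finsetSum Finset.univ fun j _ => (hX j).const_mul (Q i j))
  have hae : ∀ᵐ p : ℝ × Ω ∂((volume.restrict (Set.Ioc 0 T)).prod P), p.1 ∈ Set.Ioc 0 T :=
    Measure.quasiMeasurePreserving_fst.ae (ae_restrict_mem measurableSet_Ioc)
  -- The absolute value of `α` makes the bound valid for either sign.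
  refine hq.bdd_mul (c := Real.exp (2 * |α| * T)) (f := fun p => Real.exp (2 * α * p.1))
    (Measurable.aestronglyMeasurable (by fun_prop)) ?_
  filter_upwards [hae] with p hp
  rw [Real.norm_of_nonneg (Real.exp_pos _).le, Real.exp_le_exp]
  have h1 : α * p.1 ≤ |α| * p.1 := mul_le_mul_of_nonneg_right (le_abs_self α) hp.1.le
  have h2 : |α| * p.1 ≤ |α| * T := mul_le_mul_of_nonneg_left hp.2 (abs_nonneg α)
  linarith

theorem integral_quadratic (h : IsRegularSolution A V X W P) {t : ℝ} (ht : 0 ≤ t)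
    (Q : Matrix (Fin n) (Fin n) ℝ) :
    ∫ ω, (X t ω).ofLp ⬝ᵥ Q *ᵥ (X t ω).ofLp ∂P = (Q * secondMoment (X t) P).trace := by
  have hx := fun l => (h.memLp_state ht).eval_piLp l
  have e : ∀ ω, (X t ω).ofLp ⬝ᵥ Q *ᵥ (X t ω).ofLp
      = ∑ i, ∑ j, Q i j * (X t ω j * X t ω i) := by
    intro ω
    simp only [dotProduct, Matrix.mulVec, Finset.mul_sum]
    exact Finset.sum_congr rfl fun i _ => Finset.sum_congr rfl fun j _ => by ring
  have hi : ∀ i j, Integrable (fun ω => Q i j * (X t ω j * X t ω i)) P := fun i j =>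
    ((hx j).integrable_fun_mul (hx i)).const_mul _
  simp only [e]
  rw [integral_finsetSum _ fun i _ => integrable_finsetSum _ fun j _ => hi i j]
  refine Finset.sum_congr rfl fun i _ => ?_
  rw [integral_finsetSum _ fun j _ => hi i j]
  simp only [integral_const_mul]
  rfl

theorem integral_cost (h : IsRegularSolution A V X W P) {α : ℝ} (hα : α ≠ 0)
    {Q Y : Matrix (Fin n) (Fin n) ℝ} (hY : IsLyapunovBarSolution (shifted A α) Q Y)
    {T : ℝ} (hT : 0 ≤ T) :
    ∫ ω, (∫ t in (0 : ℝ)..T,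
        Real.exp (2 * α * t) * ((X t ω).ofLp ⬝ᵥ Q *ᵥ (X t ω).ofLp)) ∂P
      = ((secondMoment (X 0) P - Real.exp (2 * α * T) • secondMoment (X T) P
        + (1 - Real.exp (2 * α * T)) • ((2 * α)⁻¹ • (-V))) * Y).trace := by
  rw [integral_intervalIntegral_of_integrable_prod hT
    (h.integrable_exp_mul_quadratic_prod α T Q)]
  rw [← hY.integral_exp_mul_trace hα (V := V) (S := fun t => secondMoment (X t) P) hT
    (fun i j => h.intervalIntegrable_integral_state_mul_state hT i j)]
  · refine intervalIntegral.integral_congr fun t ht => ?_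
    rw [Set.uIcc_of_le hT] at ht
    simp only [integral_const_mul, h.integral_quadratic ht.1]
  · intro t ht i j
    have h1 := h.integral_state_mul_state ht.1 i j
    simp only [secondMoment, Matrix.of_apply, Matrix.add_apply, Matrix.mul_apply,
      Matrix.transpose_apply, mul_comm _ (A j _)]
    exact h1

end IsRegularSolution

end LQG

/-- Measurability of a process at a dense set of times propagates along continuous paths. -/
theorem measurable_indicator_of_dense {ι Ω E : Type*} [TopologicalSpace ι]
    [FirstCountableTopology ι] [MeasurableSpace Ω] [Zero E] [TopologicalSpace E]
    [TopologicalSpace.PseudoMetrizableSpace E] [MeasurableSpace E] [BorelSpace E]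
    {x : ι → Ω → E} {G : Set Ω} {D : Set ι} (hD : Dense D)
    (hc : ∀ ω ∈ G, Continuous fun t => x t ω) (hm : ∀ q ∈ D, Measurable (G.indicator (x q)))
    (t : ι) : Measurable (G.indicator (x t)) := by
  obtain ⟨u, huD, hut⟩ := mem_closure_iff_seq_limit.1 (hD t)
  refine measurable_of_tendsto_metrizable (fun k => hm (u k) (huD k)) (tendsto_pi_nhds.2 ?_)
  intro ω
  by_cases hω : ω ∈ G
  · simp only [Set.indicator_of_mem hω]
    exact ((hc ω hω).tendsto t).comp hut
  · simp only [Set.indicator_of_notMem hω]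
    exact tendsto_const_nhds

/-! ### Brownian moments and passage to a regular version. -/

namespace LQG

namespace IsBrownianMotion

variable {n : ℕ} {Ω : Type*} [MeasurableSpace Ω] {P : Measure Ω}
  {V : Matrix (Fin n) (Fin n) ℝ} {w : ℝ≥0 → Ω → EuclideanSpace ℝ (Fin n)}

theorem memLp_sub (hw : IsBrownianMotion V w P) {s t : ℝ≥0} (hst : s ≤ t) :
    MemLp (fun ω => w t ω - w s ω) 2 P :=
  (hw.law_increments s t hst).hasGaussianLaw.memLp_two

theorem integral_sub_eval (hw : IsBrownianMotion V w P) {s t : ℝ≥0} (hst : s ≤ t) (i : Fin n) :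
    ∫ ω, (w t ω - w s ω) i ∂P = 0 := by
  have h1 := (hw.law_increments s t hst).integral_comp
    (f := fun y : EuclideanSpace ℝ (Fin n) => y i) (by fun_prop)
  have h2 : ∫ y : EuclideanSpace ℝ (Fin n), y i
      ∂(multivariateGaussian 0 (((t : ℝ) - (s : ℝ)) • V)) = 0 := by
    rw [← eval_integral_piLp]
    · rw [integral_id_multivariateGaussian]
      rfl
    · exact fun i => (IsGaussian.integrable_id.eval_piLp i)
  rw [← h2, ← h1]
  rfl

theorem integral_sub_eval_mul_sub_eval (hw : IsBrownianMotion V w P) (hV : V.PosSemidef)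
    {s t : ℝ≥0} (hst : s ≤ t) (i j : Fin n) :
    ∫ ω, (w t ω - w s ω) i * (w t ω - w s ω) j ∂P = ((t : ℝ) - s) * V i j := by
  have hS : (((t : ℝ) - (s : ℝ)) • V).PosSemidef :=
    hV.smul (sub_nonneg.2 (NNReal.coe_le_coe.2 hst))
  have h1 := (hw.law_increments s t hst).covariance_fun_comp
    (f := fun y : EuclideanSpace ℝ (Fin n) => y i)
    (g := fun y : EuclideanSpace ℝ (Fin n) => y j) (by fun_prop) (by fun_prop)
  rw [covariance_eval_multivariateGaussian hS, covariance, hw.integral_sub_eval hst,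
    hw.integral_sub_eval hst] at h1
  simpa only [sub_zero, Matrix.smul_apply, smul_eq_mul] using h1

theorem sub_zero_ae_eq (hw : IsBrownianMotion V w P) (t : ℝ≥0) :
    (fun ω => w t ω - w 0 ω) =ᵐ[P] w t := by
  filter_upwards [hw.start_zero] with ω hω
  rw [hω, sub_zero]

theorem memLp (hw : IsBrownianMotion V w P) (t : ℝ≥0) : MemLp (w t) 2 P :=
  (memLp_congr_ae (hw.sub_zero_ae_eq t)).1 (hw.memLp_sub zero_le)

theorem integral_eval (hw : IsBrownianMotion V w P) (t : ℝ≥0) (i : Fin n) :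
    ∫ ω, w t ω i ∂P = 0 := by
  rw [← hw.integral_sub_eval (zero_le (a := t)) i]
  refine integral_congr_ae ?_
  filter_upwards [hw.sub_zero_ae_eq t] with ω hω
  rw [hω]

/-- Split `w t = w s + (w t - w s)`: the increment is centred and independent of `w s`, so only the
covariance at time `s` survives. -/
theorem integral_eval_mul_eval (hw : IsBrownianMotion V w P) (hV : V.PosSemidef) {s t : ℝ≥0}
    (hst : s ≤ t) (i j : Fin n) : ∫ ω, w s ω i * w t ω j ∂P = s * V i j := by
  have hs := (hw.memLp s).eval_piLp i
  have hd := (hw.memLp_sub hst).eval_piLp j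
  have h1 : ∫ ω, w s ω i * w s ω j ∂P = s * V i j := by
    have := hw.integral_sub_eval_mul_sub_eval hV (zero_le (a := s)) i j
    rw [NNReal.coe_zero, sub_zero] at this
    rw [← this]
    refine integral_congr_ae ?_
    filter_upwards [hw.sub_zero_ae_eq s] with ω hω
    rw [hω]
  have hind : IndepFun (fun ω => w s ω i) (fun ω => (w t ω - w s ω) j) P :=
    (hw.indep_increments.indepFun_eval_sub (zero_le (a := s)) hst hw.start_zero).comp
      (φ := fun y : EuclideanSpace ℝ (Fin n) => y i)
      (ψ := fun y : EuclideanSpace ℝ (Fin n) => y j) (by fun_prop) (by fun_prop)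
  have h2 : ∫ ω, w s ω i * (w t ω - w s ω) j ∂P = 0 := by
    rw [hind.integral_fun_mul_eq_mul_integral hs.1 hd.1, hw.integral_eval s i, zero_mul]
  have e : ∀ ω, w s ω i * w t ω j = w s ω i * (w t ω - w s ω) j + w s ω i * w s ω j := by
    intro ω
    rw [PiLp.sub_apply]
    ring
  simp only [e]
  rw [integral_add (hs.integrable_fun_mul hd)
    (hs.integrable_fun_mul ((hw.memLp s).eval_piLp j)), h1, h2, zero_add]

end IsBrownianMotion

/-- Every solution has a regular version that agrees with it almost surely at all times. -/
theorem IsSolution.exists_isRegularSolution {n : ℕ} {Ω : Type*} [MeasurableSpace Ω]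
    {P : Measure Ω} {A V : Matrix (Fin n) (Fin n) ℝ}
    {w x : ℝ≥0 → Ω → EuclideanSpace ℝ (Fin n)} (hx : IsSolution A w x P)
    (hV : V.PosSemidef) (hw : IsBrownianMotion V w P) (hx₀ : HasGaussianLaw (x 0) P)
    (hindep : IndepFun (x 0) (fun ω t ↦ w t ω) P) :
    ∃ X W : ℝ → Ω → EuclideanSpace ℝ (Fin n), IsRegularSolution A V X W P ∧
      ∀ᵐ ω ∂P, ∀ t, X t ω = x t.toNNReal ω := by
  have hwm : ∀ t, AEMeasurable (w t) P := fun t => (hw.memLp t).1.aemeasurable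
  -- Countably many times suffice: agreement with measurable versions then holds off one null set,
  -- and continuity of paths carries measurability to all times.
  let d := TopologicalSpace.denseSeq ℝ≥0
  have hgood : ∀ᵐ ω ∂P, (Continuous (fun t ↦ x t ω)) ∧ (Continuous (fun t ↦ w t ω)) ∧
      (∀ t : ℝ≥0, x t ω = x 0 ω
        + (∫ s in (0 : ℝ)..(t : ℝ), Matrix.toEuclideanCLM (𝕜 := ℝ) A (x s.toNNReal ω))
        + w t ω) ∧
      (∀ k, x (d k) ω = (hx.aemeasurable (d k)).mk _ ω) ∧
      ∀ k, w (d k) ω = (hwm (d k)).mk _ ω := by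
    filter_upwards [hx.continuous_paths, hw.continuous_paths, hx.integral_eq,
      ae_all_iff.2 fun k => (hx.aemeasurable (d k)).ae_eq_mk,
      ae_all_iff.2 fun k => (hwm (d k)).ae_eq_mk] with ω h1 h2 h3 h4 h5
    exact ⟨h1, h2, h3, h4, h5⟩
  obtain ⟨G, hGsub, hGm, hGP⟩ := exists_measurable_superset_of_null hgood
  obtain ⟨hGae, hG⟩ : (∀ᵐ ω ∂P, ω ∈ Gᶜ) ∧ ∀ ω ∈ Gᶜ, _ :=
    ⟨measure_eq_zero_iff_ae_notMem.1 hGP,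
      fun ω hω => not_not.1 fun hn => hω (hGsub hn)⟩
  have hmeas : ∀ {y : ℝ≥0 → Ω → EuclideanSpace ℝ (Fin n)} (hy : ∀ t, AEMeasurable (y t) P),
      (∀ ω ∈ Gᶜ, Continuous fun t => y t ω) → (∀ ω ∈ Gᶜ, ∀ k, y (d k) ω = (hy (d k)).mk _ ω) →
      ∀ t, Measurable (Gᶜ.indicator (y t)) := by
    intro y hy hc hk
    refine measurable_indicator_of_dense (TopologicalSpace.denseRange_denseSeq ℝ≥0) hc ?_
    rintro _ ⟨k, rfl⟩
    have : Gᶜ.indicator (y (d k)) = Gᶜ.indicator ((hy (d k)).mk _) :=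
      Set.indicator_congr fun ω hω => hk ω hω k
    rw [this]
    exact (hy (d k)).measurable_mk.indicator hGm.compl
  have hcont : ∀ {y : ℝ≥0 → Ω → EuclideanSpace ℝ (Fin n)},
      (∀ ω ∈ Gᶜ, Continuous fun t => y t ω) →
      ∀ ω, Continuous fun t : ℝ => Gᶜ.indicator (y t.toNNReal) ω := by
    intro y hc ω
    by_cases hω : ω ∈ Gᶜ
    · simp only [Set.indicator_of_mem hω]
      exact (hc ω hω).comp continuous_real_toNNReal
    · simp only [Set.indicator_of_notMem hω]
      exact continuous_const
  have hae : ∀ y : ℝ≥0 → Ω → EuclideanSpace ℝ (Fin n), ∀ᵐ ω ∂P, ∀ t : ℝ,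
      Gᶜ.indicator (y t.toNNReal) ω = y t.toNNReal ω := by
    intro y
    filter_upwards [hGae] with ω hω t using Set.indicator_of_mem hω _
  -- Both processes are set to zero on the exceptional null set, where the integral equation then
  -- holds trivially.
  refine ⟨fun t => Gᶜ.indicator (x t.toNNReal), fun t => Gᶜ.indicator (w t.toNNReal),
    ⟨fun t => hmeas hx.aemeasurable (fun ω hω => (hG ω hω).1) (fun ω hω => (hG ω hω).2.2.2.1) _,
    hcont fun ω hω => (hG ω hω).1,
    fun t => hmeas hwm (fun ω hω => (hG ω hω).2.1) (fun ω hω => (hG ω hω).2.2.2.2) _,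
    hcont fun ω hω => (hG ω hω).2.1, ?_, ?_, ?_, ?_, ?_⟩, hae x⟩
  · intro ω t ht
    by_cases hω : ω ∈ Gᶜ
    · simp only [Set.indicator_of_mem hω]
      have := (hG ω hω).2.2.1 t.toNNReal
      rwa [Real.coe_toNNReal t ht, ← Real.toNNReal_zero] at this
    · simp [Set.indicator_of_notMem hω]
  · refine (memLp_congr_ae ?_).1 hx₀.memLp_two
    filter_upwards [hae x] with ω hω
    rw [hω 0, Real.toNNReal_zero]
  · intro t _
    refine (memLp_congr_ae ?_).1 (hw.memLp t.toNNReal)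
    filter_upwards [hae w] with ω hω
    rw [hω t]
  · intro s t hs hst i j
    have h1 := hw.integral_eval_mul_eval hV (Real.toNNReal_le_toNNReal hst) i j
    rw [Real.coe_toNNReal s hs] at h1
    rw [← h1]
    refine integral_congr_ae ?_
    filter_upwards [hae w] with ω hω
    rw [hω s, hω t]
  · intro t ht i j
    have hind : IndepFun (fun ω => x 0 ω i) (fun ω => w t.toNNReal ω j) P :=
      hindep.comp (φ := fun y : EuclideanSpace ℝ (Fin n) => y i)
        (ψ := fun f : ℝ≥0 → EuclideanSpace ℝ (Fin n) => f t.toNNReal j) (by fun_prop)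
        (by fun_prop)
    have h1 := hind.integral_fun_mul_eq_mul_integral (hx₀.memLp_two.eval_piLp i).1
      ((hw.memLp t.toNNReal).eval_piLp j).1
    rw [hw.integral_eval, mul_zero] at h1
    refine Eq.trans ?_ h1
    refine integral_congr_ae ?_
    filter_upwards [hae w, hae x] with ω hω hω'
    rw [hω t, hω' 0, Real.toNNReal_zero]

end LQG

/-! ### The finite-horizon cost formula. -/

theorem theorem1 {n : ℕ} {Ω : Type*} [MeasurableSpace Ω] (P : Measure Ω) [IsProbabilityMeasure P]
    (A V Q : Matrix (Fin n) (Fin n) ℝ) (hV : V.PosSemidef) (hQ : Q.IsSymm)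
    (w x : ℝ≥0 → Ω → EuclideanSpace ℝ (Fin n))
    (hw : LQG.IsBrownianMotion V w P)
    (hx : LQG.IsSolution A w x P)
    (hx₀ : HasGaussianLaw (x 0) P)
    (hindep : IndepFun (x 0) (fun ω t ↦ w t ω) P)
    (α : ℝ) (hα : α ≠ 0)
    (hA : LQG.IsSylvester A) (hAα : LQG.IsSylvester (LQG.shifted A α))
    (T : ℝ≥0) :
    (∃! X : Matrix (Fin n) (Fin n) ℝ, LQG.IsLyapunovBarSolution (LQG.shifted A α) Q X) ∧
    MemLp (x 0) 2 P ∧ MemLp (x T) 2 P ∧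
    Integrable (LQG.finiteTimeCost α Q x T) P ∧
    ∀ X : Matrix (Fin n) (Fin n) ℝ, LQG.IsLyapunovBarSolution (LQG.shifted A α) Q X →
      ∫ ω, LQG.finiteTimeCost α Q x T ω ∂P =
        Matrix.trace
          ((LQG.secondMoment (x 0) P
            - Real.exp (2 * α * T) • LQG.secondMoment (x T) P
            + (1 - Real.exp (2 * α * T)) • ((2 * α)⁻¹ • (-V))) * X) := by
  obtain ⟨Y, W, hY, hYx⟩ := hx.exists_isRegularSolution hV hw hx₀ hindep
  have hT : (0 : ℝ) ≤ T := T.coe_nonneg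
  have hcost : (fun ω => ∫ t in (0 : ℝ)..(T : ℝ),
      Real.exp (2 * α * t) * ((Y t ω).ofLp ⬝ᵥ Q *ᵥ (Y t ω).ofLp))
      =ᵐ[P] LQG.finiteTimeCost α Q x T := by
    filter_upwards [hYx] with ω hω
    simp only [hω, LQG.finiteTimeCost]
  have hYT : Y T =ᵐ[P] x T := by
    filter_upwards [hYx] with ω hω
    rw [hω T, Real.toNNReal_coe]
  have hY0 : Y 0 =ᵐ[P] x 0 := by
    filter_upwards [hYx] with ω hω
    rw [hω 0, Real.toNNReal_zero]
  have hmoment : ∀ {y z : Ω → EuclideanSpace ℝ (Fin n)}, y =ᵐ[P] z →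
      LQG.secondMoment y P = LQG.secondMoment z P := by
    intro y z hyz
    ext i j
    refine integral_congr_ae ?_
    filter_upwards [hyz] with ω hω
    rw [hω]
  refine ⟨hAα.existsUnique_isLyapunovBarSolution Q, hx₀.memLp_two,
    (memLp_congr_ae hYT).1 (hY.memLp_state hT),
    (integrable_intervalIntegral_of_integrable_prod hT
      (hY.integrable_exp_mul_quadratic_prod α T Q)).congr hcost, fun X hX => ?_⟩
  rw [← integral_congr_ae hcost, ← hmoment hY0, ← hmoment hYT]
  exact hY.integral_cost hα hX hT
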